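/- Let $E$ and $F$ be real Banach lattices, and let $L(E,F)$ be the space of bounded linear operators from $E$ to $F$, ordered by $S\le T$ iff $Sx\le Tx$ for all $x\ge 0$. The modulus $|T|$ of $T\in L(E,F)$, if it exists, is the supremum of $\{T,-T\}$ in $L(E,F)$. For $\mathcal P\subseteq L(E,F)$, an operator $T$ is an r-$\mathcal P$-operator if $T=T_1-T_2$ with positive $T_1,T_2\in\mathcal P$; the set of these is denoted by $\text{r-}\mathcal P(E,F)$. We say that $T\in L(E,F)$ is $\mathcal P$-dominated if $\pm T\le U$ for some $U\in\mathcal P$, and that $\mathcal P$ has the domination property if $0\le S\le T\in\mathcal P$ implies $S\in\mathcal P$. Let $L_r(E,F)$ be the ordered vector space of regular operators, i.e. of differences of positive operators. A bounded set $A\subseteq E$ is limited if each weak$^*$-null sequence in $E'$ converges to $0$ uniformly on $A$. A set $A\subseteq F$ is an Lwc-set if each disjoint sequence in its solid hull $\bigcup_{a\in A}[-|a|,|a|]$ is norm-null. Let $\text{l-Lwc}(E,F)$ be the set of all $T\in L(E,F)$ that carry limited subsets of $E$ to Lwc-subsets of $F$. (a) If $T\in L(E,F)$ possesses a modulus, then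 $T\in\text{r-l-Lwc}(E,F)$ if and only if $|T|\in\text{r-l-Lwc}(E,F)$. (b) Let $\emptyset\neq\mathcal P\subseteq L(E,F)$ be closed under sums and differences, and let $T\in L(E,F)$. Then: (i) $T$ is an r-$\mathcal P$-operator if and only if $T$ belongs to $\mathcal P$ and is $\mathcal P$-dominated; (ii) if $|T|$ exists in $L(E,F)$ and $\mathcal P$ has the domination property, then $T$ is an r-$\mathcal P$-operator if and only if $|T|\in\mathcal P$. (c) Let $F$ be Dedekind complete. Then $L_r(E,F)$ is a Dedekind complete vector lattice, and for every vector subspace $\mathcal P$ of $L(E,F)$ with the domination property, $\text{r-}\mathcal P(E,F)$ is an order ideal (a solid vector subspace) of $L_r(E,F)$. -/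

import Mathlib

open Filter Topology

namespace BanachLat

section OrderNotions

/-- `M` is the modulus of `T`, i.e. the supremum `T ∨ (-T)` in the ordered vector space `V`. -/
def IsModulus {V : Type*} [Neg V] [Preorder V] (T M : V) : Prop :=
  IsLUB {T, -T} M

/-- Dedekind completeness: each nonempty subset that is bounded above has a supremum. -/
def IsDedekindComplete (V : Type*) [Preorder V] : Prop :=
  ∀ A : Set V, A.Nonempty → BddAbove A → ∃ s, IsLUB A s

/-- The real vector space `V` with the given partial order is a vector lattice (Riesz space). -/
structure IsVectorLattice (V : Type*) [AddCommGroup V] [Module ℝ V] [PartialOrder V] : Prop where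
  add_le_add_right : ∀ a b c : V, a ≤ b → a + c ≤ b + c
  smul_le_smul : ∀ (r : ℝ) (a b : V), 0 ≤ r → a ≤ b → r • a ≤ r • b
  exists_sup : ∀ a b : V, ∃ s, IsLUB {a, b} s
  exists_inf : ∀ a b : V, ∃ s, IsGLB {a, b} s

/-- `I` is an order ideal of the vector lattice `V`: a solid vector subspace, i.e. a vector
subspace such that `|S| ≤ |T|` and `T ∈ I` imply `S ∈ I`. -/
structure IsOrderIdeal {V : Type*} [AddCommGroup V] [Module ℝ V] [PartialOrder V]
    (I : Set V) : Prop where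
  zero_mem : 0 ∈ I
  add_mem : ∀ S T : V, S ∈ I → T ∈ I → S + T ∈ I
  smul_mem : ∀ (r : ℝ) (T : V), T ∈ I → r • T ∈ I
  solid : ∀ S T absS absT : V, IsModulus S absS → IsModulus T absT → absS ≤ absT →
    T ∈ I → S ∈ I

end OrderNotions

section LimitedSets

/-- A bounded set `A` is limited if each weak-star null sequence in the dual is uniformly null
on `A`. -/
def IsLimited {X : Type*} [NormedAddCommGroup X] [NormedSpace ℝ X] (A : Set X) : Prop :=
  Bornology.IsBounded A ∧
    ∀ f : ℕ → StrongDual ℝ X, (∀ x, Tendsto (fun n => f n x) atTop (𝓝 0)) →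
      TendstoUniformlyOn (fun n x => f n x) (fun _ => 0) atTop A

/-- A sequence in a vector lattice is disjoint if its terms are pairwise disjoint. -/
def IsDisjointSeq {F : Type*} [AddCommGroup F] [Lattice F] (a : ℕ → F) : Prop :=
  ∀ m n, m ≠ n → |a m| ⊓ |a n| = 0

/-- `A` is an Lwc-set if each disjoint sequence in its solid hull is norm-null. -/
def IsLwcSet {F : Type*} [NormedAddCommGroup F] [Lattice F] (A : Set F) : Prop :=
  ∀ a : ℕ → F, (∀ n, a n ∈ LatticeOrderedAddCommGroup.solidClosure A) → IsDisjointSeq a →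
    Tendsto (fun n => ‖a n‖) atTop (𝓝 0)

/-- The limitedly L-weakly compact operators: those bounded operators that carry limited sets to
Lwc-sets. -/
def lLwc (X F : Type*) [NormedAddCommGroup X] [NormedSpace ℝ X]
    [NormedAddCommGroup F] [NormedSpace ℝ F] [Lattice F] : Set (X →L[ℝ] F) :=
  {T | ∀ A : Set X, IsLimited A → IsLwcSet (T '' A)}

end LimitedSets

section Operators

variable {E F : Type*}
  [NormedAddCommGroup E] [NormedSpace ℝ E] [Lattice E] [IsOrderedAddMonoid E]
  [NormedAddCommGroup F] [NormedSpace ℝ F] [Lattice F] [IsOrderedAddMonoid F]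
  [IsOrderedModule ℝ F]

/-- The order of operators: `S ≤ T` iff `S x ≤ T x` for all `x ≥ 0`. -/
instance instOperatorOrder : PartialOrder (E →L[ℝ] F) where
  le S T := ∀ x, 0 ≤ x → S x ≤ T x
  le_refl _ _ _ := le_rfl
  le_trans _ _ _ h₁ h₂ x hx := (h₁ x hx).trans (h₂ x hx)
  le_antisymm S T h₁ h₂ := by
    have key : ∀ x : E, 0 ≤ x → S x = T x := fun x hx => le_antisymm (h₁ x hx) (h₂ x hx)
    ext x
    rw [← posPart_sub_negPart x, map_sub, map_sub, key _ (posPart_nonneg x),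
      key _ (negPart_nonneg x)]

/-- The r-`P`-operators: differences of two positive operators that belong to `P`. -/
def rOps (P : Set (E →L[ℝ] F)) : Set (E →L[ℝ] F) :=
  {T | ∃ T₁ ∈ P, ∃ T₂ ∈ P, 0 ≤ T₁ ∧ 0 ≤ T₂ ∧ T = T₁ - T₂}

/-- The domination property: `0 ≤ S ≤ T ∈ P` implies `S ∈ P`. -/
def HasDominationProperty (P : Set (E →L[ℝ] F)) : Prop :=
  ∀ S T : E →L[ℝ] F, 0 ≤ S → S ≤ T → T ∈ P → S ∈ P

/-- `T` is `P`-dominated: `± T ≤ U` for some `U ∈ P`. -/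
def IsDominatedBy (P : Set (E →L[ℝ] F)) (T : E →L[ℝ] F) : Prop :=
  ∃ U ∈ P, T ≤ U ∧ -T ≤ U

variable (E F) in
/-- The space of regular operators: differences of two positive operators, with the operator
order inherited from the space of all bounded operators. -/
def regularOps : Submodule ℝ (E →L[ℝ] F) where
  carrier := {T | ∃ T₁ T₂ : E →L[ℝ] F, 0 ≤ T₁ ∧ 0 ≤ T₂ ∧ T = T₁ - T₂}
  zero_mem' := ⟨0, 0, le_rfl, le_rfl, by simp⟩
  add_mem' := by
    rintro _ _ ⟨A, B, hA, hB, rfl⟩ ⟨C, D, hC, hD, rfl⟩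
    exact ⟨A + C, B + D, fun x hx => add_nonneg (hA x hx) (hC x hx),
      fun x hx => add_nonneg (hB x hx) (hD x hx), by abel⟩
  smul_mem' := by
    rintro r _ ⟨A, B, hA, hB, rfl⟩
    rcases le_total 0 r with hr | hr
    · exact ⟨r • A, r • B, fun x hx => smul_nonneg hr (hA x hx),
        fun x hx => smul_nonneg hr (hB x hx), smul_sub r A B⟩
    · refine ⟨(-r) • B, (-r) • A, fun x hx => smul_nonneg (neg_nonneg.2 hr) (hB x hx),
        fun x hx => smul_nonneg (neg_nonneg.2 hr) (hA x hx), ?_⟩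
      rw [smul_sub, neg_smul, neg_smul]
      abel

end Operators

end BanachLat

/-! Statement (b) is order algebra: if `± T ≤ U` then `T = U - (U - T)`, and if `± T ≤ M` then `T`
is the difference of the positive halves of `M + T` and `M - T`, both below `M`. Statement (a) is
(b)(ii) applied to `lLwc E F`, once this class is known to be closed under sums and differences and
to have the domination property. All three follow from `mem_lLwc_iff`: limited sets can be replaced
by points, and the vectors `y` with `{y}` an Lwc-set form an ideal of `F`. Its proof measures the
part of `y` in the band of `a` by `bandSeminorm a y`; Hahn–Banach functionals below these seminorms,
composed with `T`, are weak-star null, hence uniformly null on limited sets. Statement (c) rests on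
the Riesz–Kantorovich construction of suprema of operators; solidity uses the same halves as (b). -/

namespace BanachLat

/-! ### Truncations in a vector lattice -/

section VectorLattice

variable {F : Type*} [AddCommGroup F] [Module ℝ F] [Lattice F] [IsOrderedAddMonoid F]
  [IsOrderedModule ℝ F]

omit [IsOrderedAddMonoid F] in
theorem smul_inf_of_nonneg {c : ℝ} (hc : 0 ≤ c) (x y : F) : c • (x ⊓ y) = c • x ⊓ c • y := by
  rcases hc.eq_or_lt with rfl | hc
  · simp
  · exact map_inf (OrderIso.smulRight (β := F) hc) x y

theorem abs_smul_lattice (c : ℝ) (x : F) : |c • x| = |c| • |x| := by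
  have key : ∀ (c : ℝ) (x : F), 0 ≤ c → |c • x| = c • |x| := by
    intro c x hc
    rcases hc.eq_or_lt with rfl | hc
    · simp
    · have h : c • (x ⊔ -x) = c • x ⊔ c • -x := (OrderIso.smulRight (β := F) hc).map_sup x (-x)
      rw [smul_neg] at h
      exact h.symm
  rcases le_total 0 c with hc | hc
  · rw [key c x hc, abs_of_nonneg hc]
  · rw [← abs_neg, ← neg_smul, key _ x (neg_nonneg.2 hc), abs_of_nonpos hc]

omit [Module ℝ F] [IsOrderedModule ℝ F] in
theorem abs_add_inf_le {w : F} (hw : 0 ≤ w) (x y : F) :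
    |x + y| ⊓ w ≤ |x| ⊓ w + |y| ⊓ w := by
  rw [add_inf, inf_add, inf_add]
  refine le_inf (le_inf ?_ ?_) (le_inf ?_ ?_)
  · exact inf_le_left.trans (abs_add_le x y)
  · exact inf_le_right.trans (le_add_of_nonneg_right (abs_nonneg y))
  · exact inf_le_right.trans (le_add_of_nonneg_left (abs_nonneg x))
  · exact inf_le_right.trans (le_add_of_nonneg_left hw)

/-- Truncations of a fixed vector by multiples of the terms of a disjoint sequence are disjoint. -/
theorem IsDisjointSeq.truncate {a : ℕ → F} (ha : IsDisjointSeq a) (y : F) (k : ℕ → ℝ) :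
    IsDisjointSeq (fun n => |y| ⊓ |k n • a n|) := by
  intro m n hmn
  have hpos : ∀ i, 0 ≤ |y| ⊓ |k i • a i| := fun i => le_inf (abs_nonneg _) (abs_nonneg _)
  simp only [abs_of_nonneg (hpos _)]
  refine le_antisymm ?_ (le_inf (hpos m) (hpos n))
  set c : ℝ := max |k m| |k n| with hc
  have hc0 : 0 ≤ c := (abs_nonneg _).trans (le_max_left _ _)
  calc (|y| ⊓ |k m • a m|) ⊓ (|y| ⊓ |k n • a n|) ≤ c • |a m| ⊓ c • |a n| := by
        refine inf_le_inf (inf_le_right.trans ?_) (inf_le_right.trans ?_)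
        · rw [abs_smul_lattice]
          exact smul_le_smul_of_nonneg_right (le_max_left _ _) (abs_nonneg _)
        · rw [abs_smul_lattice]
          exact smul_le_smul_of_nonneg_right (le_max_right _ _) (abs_nonneg _)
    _ = 0 := by rw [← smul_inf_of_nonneg hc0, ha m n hmn, smul_zero]

end VectorLattice

/-! ### Band seminorms and Lwc singletons -/

section NormedLattice

variable {F : Type*} [NormedAddCommGroup F] [NormedSpace ℝ F] [Lattice F] [IsOrderedAddMonoid F]
  [IsOrderedModule ℝ F] [HasSolidNorm F]

omit [NormedSpace ℝ F] [IsOrderedModule ℝ F] in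
theorem norm_abs_inf_abs_le (y w : F) : ‖|y| ⊓ |w|‖ ≤ ‖y‖ := by
  refine norm_le_norm_of_abs_le_abs ?_
  rw [abs_of_nonneg (le_inf (abs_nonneg y) (abs_nonneg w))]
  exact inf_le_left

omit [IsOrderedModule ℝ F] in
theorem bddAbove_range_norm_truncate (a y : F) :
    BddAbove (Set.range fun k : ℝ => ‖|y| ⊓ |k • a|‖) :=
  ⟨‖y‖, by rintro _ ⟨k, rfl⟩; exact norm_abs_inf_abs_le y (k • a)⟩

/-- The seminorm `y ↦ sup_k ‖|y| ⊓ |k a|‖`, which measures the part of `y` in the band generated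
by `a`. -/
noncomputable def bandSeminorm (a : F) : Seminorm ℝ F :=
  Seminorm.ofSMulLE (fun y => ⨆ k : ℝ, ‖|y| ⊓ |k • a|‖)
    (by simp)
    (by
      intro x y
      refine ciSup_le fun k => ?_
      have h0 : ∀ z : F, 0 ≤ |z| ⊓ |k • a| := fun z => le_inf (abs_nonneg _) (abs_nonneg _)
      calc ‖|x + y| ⊓ |k • a|‖ ≤ ‖|x| ⊓ |k • a| + |y| ⊓ |k • a|‖ := by
            refine norm_le_norm_of_abs_le_abs ?_
            rw [abs_of_nonneg (h0 _), abs_of_nonneg (add_nonneg (h0 _) (h0 _))]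
            exact abs_add_inf_le (abs_nonneg _) x y
        _ ≤ ‖|x| ⊓ |k • a|‖ + ‖|y| ⊓ |k • a|‖ := norm_add_le _ _
        _ ≤ _ := add_le_add (le_ciSup (bddAbove_range_norm_truncate a x) k)
            (le_ciSup (bddAbove_range_norm_truncate a y) k))
    (by
      intro r y
      rcases eq_or_ne r 0 with rfl | hr
      · simp
      refine ciSup_le fun k => ?_
      -- Rescaling `y` only reparametrizes `k`, so the supremum over all real `k` is homogeneous.
      have h : |r • y| ⊓ |k • a| = |r| • (|y| ⊓ |(r⁻¹ * k) • a|) := by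
        rw [smul_inf_of_nonneg (abs_nonneg r), ← abs_smul_lattice, ← abs_smul_lattice, smul_smul,
          mul_inv_cancel_left₀ hr]
      rw [h, norm_smul, Real.norm_eq_abs, Real.norm_eq_abs, abs_abs]
      exact mul_le_mul_of_nonneg_left (le_ciSup (bddAbove_range_norm_truncate a y) (r⁻¹ * k))
        (abs_nonneg r))

theorem norm_truncate_le_bandSeminorm (a y : F) (k : ℝ) :
    ‖|y| ⊓ |k • a|‖ ≤ bandSeminorm a y :=
  le_ciSup (bddAbove_range_norm_truncate a y) k

theorem bandSeminorm_le_norm (a y : F) : bandSeminorm a y ≤ ‖y‖ :=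
  ciSup_le fun k => norm_abs_inf_abs_le y (k • a)

theorem norm_le_bandSeminorm {a y : F} (h : |a| ≤ |y|) : ‖a‖ ≤ bandSeminorm a y := by
  simpa [inf_eq_right.2 h, norm_abs_eq_norm] using norm_truncate_le_bandSeminorm a y 1

/-- If each disjoint sequence in `[-|y|, |y|]` is norm-null, then the part of `y` in the bands
generated by the terms of a disjoint sequence is norm-null. -/
theorem tendsto_bandSeminorm {y : F} (hy : IsLwcSet {y}) {a : ℕ → F} (ha : IsDisjointSeq a) :
    Tendsto (fun n => bandSeminorm (a n) y) atTop (𝓝 0) := by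
  -- Near-maximizers of the supremum give a disjoint sequence of truncations in `[-|y|, |y|]`.
  have hk : ∀ n : ℕ, ∃ k : ℝ, bandSeminorm (a n) y - 1 / ((n : ℝ) + 1) < ‖|y| ⊓ |k • a n|‖ :=
    fun n => exists_lt_of_lt_ciSup (sub_lt_self _ Nat.one_div_pos_of_nat)
  choose k hk using hk
  have h1 : Tendsto (fun n => ‖|y| ⊓ |k n • a n|‖) atTop (𝓝 0) := by
    refine hy _ (fun n => ⟨y, rfl, ?_⟩) (ha.truncate y k)
    rw [abs_of_nonneg (le_inf (abs_nonneg _) (abs_nonneg _))]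
    exact inf_le_left
  have h2 := h1.add (tendsto_one_div_add_atTop_nhds_zero_nat (𝕜 := ℝ))
  rw [add_zero] at h2
  exact squeeze_zero (fun n => apply_nonneg _ _) (fun n => by linarith [hk n]) h2

omit [NormedSpace ℝ F] [IsOrderedAddMonoid F] [IsOrderedModule ℝ F] [HasSolidNorm F] in
theorem IsLwcSet.singleton_of_abs_le {x y : F} (hy : IsLwcSet {y}) (h : |x| ≤ |y|) :
    IsLwcSet {x} := by
  intro a ha
  refine hy a fun n => ?_
  obtain ⟨z, rfl, hz⟩ := ha n
  exact ⟨y, rfl, hz.trans h⟩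

/-- Subadditivity of the band seminorm gives `‖a n‖ ≤ bandSeminorm (a n) x + bandSeminorm (a n) y`,
so the terms `a n` need not be split along `x + y`. -/
theorem IsLwcSet.singleton_add {x y : F} (hx : IsLwcSet {x}) (hy : IsLwcSet {y}) :
    IsLwcSet {x + y} := by
  intro a ha hd
  have h := (tendsto_bandSeminorm hx hd).add (tendsto_bandSeminorm hy hd)
  rw [add_zero] at h
  refine squeeze_zero (fun n => norm_nonneg _) (fun n => ?_) h
  obtain ⟨z, rfl, hz⟩ := ha n
  exact (norm_le_bandSeminorm hz).trans (map_add_le_add _ x y)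

omit [NormedSpace ℝ F] [IsOrderedAddMonoid F] [IsOrderedModule ℝ F] [HasSolidNorm F] in
theorem IsLwcSet.singleton_neg {x : F} (hx : IsLwcSet {x}) : IsLwcSet {-x} :=
  hx.singleton_of_abs_le (abs_neg x).le

omit [Lattice F] [IsOrderedAddMonoid F] [IsOrderedModule ℝ F] [HasSolidNorm F] in
/-- A seminorm below the norm has norming functionals. -/
theorem exists_dual_of_seminorm (p : Seminorm ℝ F) (hp : ∀ y, p y ≤ ‖y‖) (v : F) :
    ∃ g : StrongDual ℝ F, (∀ y, |g y| ≤ p y) ∧ g v = p v := by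
  rcases eq_or_ne v 0 with rfl | hv
  · exact ⟨0, fun y => by simp, by simp⟩
  let f : F →ₗ.[ℝ] ℝ := LinearPMap.mkSpanSingleton v (p v) hv
  obtain ⟨g, hg, hgp⟩ := Module.Dual.exists_extension_of_le_seminorm_real f.domain f.toFun (p := p)
    (by
      rintro ⟨x, hx⟩
      obtain ⟨c, rfl⟩ := Submodule.mem_span_singleton.1 hx
      have h : f.toFun ⟨c • v, hx⟩ = c • p v := LinearPMap.mkSpanSingleton'_apply v (p v) _ c hx
      rw [h, map_smul_eq_mul, smul_eq_mul]
      exact mul_le_mul_of_nonneg_right (le_abs_self c) (apply_nonneg p v))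
  refine ⟨g.mkContinuous 1 fun y => by simpa using (hgp y).trans (hp y), hgp, ?_⟩
  have hm : v ∈ f.domain := Submodule.mem_span_singleton_self v
  have h1 := hg ⟨v, hm⟩
  have h2 : f.toFun ⟨v, hm⟩ = p v := LinearPMap.mkSpanSingleton_apply ℝ ℝ hv (p v)
  exact h1.trans h2

end NormedLattice

/-! ### Limitedly L-weakly compact operators -/

section LimitedlyLwc

variable {E F : Type*} [NormedAddCommGroup E] [NormedSpace ℝ E]
  [NormedAddCommGroup F] [NormedSpace ℝ F] [Lattice F] [IsOrderedAddMonoid F]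
  [IsOrderedModule ℝ F] [HasSolidNorm F]

theorem isLimited_singleton (x : E) : IsLimited {x} :=
  ⟨Bornology.isBounded_singleton, fun f hf => by
    simpa [tendstoUniformlyOn_singleton_iff_tendsto] using hf x⟩

/-- An operator is limitedly L-weakly compact iff its range lies in the order continuous part. -/
theorem mem_lLwc_iff {T : E →L[ℝ] F} : T ∈ lLwc E F ↔ ∀ x, IsLwcSet {T x} := by
  refine ⟨fun h x => by simpa using h {x} (isLimited_singleton x), fun h A hA a ha hd => ?_⟩
  choose y hy hay using ha
  choose x hx hxy using hy
  choose g hgp hg using fun n =>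
    exists_dual_of_seminorm (bandSeminorm (a n)) (bandSeminorm_le_norm (a n)) (T (x n))
  -- Domination of `g n` by the band seminorm of `a n`, not merely by the norm, makes the
  -- functionals weak-star null; limitedness then allows evaluation at the moving points `x n`.
  have hnull : ∀ z, Tendsto (fun n => (g n ∘L T) z) atTop (𝓝 0) := fun z =>
    squeeze_zero_norm (fun n => hgp n (T z)) (tendsto_bandSeminorm (h z) hd)
  have hunif := hA.2 (fun n => g n ∘L T) hnull
  rw [Metric.tendstoUniformlyOn_iff] at hunif
  rw [Metric.tendsto_atTop]
  intro ε hε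
  obtain ⟨N, hN⟩ := eventually_atTop.1 (hunif ε hε)
  refine ⟨N, fun n hn => ?_⟩
  have h1 := hN n hn (x n) (hx n)
  have h2 : ‖a n‖ ≤ g n (T (x n)) := by
    rw [hg]
    exact norm_le_bandSeminorm (by rw [hxy]; exact hay n)
  rw [dist_zero_left, ContinuousLinearMap.comp_apply, Real.norm_eq_abs] at h1
  rw [dist_zero_right, norm_norm]
  exact (h2.trans (le_abs_self _)).trans_lt h1

theorem add_mem_lLwc {S T : E →L[ℝ] F} (hS : S ∈ lLwc E F) (hT : T ∈ lLwc E F) :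
    S + T ∈ lLwc E F :=
  mem_lLwc_iff.2 fun x => (mem_lLwc_iff.1 hS x).singleton_add (mem_lLwc_iff.1 hT x)

theorem sub_mem_lLwc {S T : E →L[ℝ] F} (hS : S ∈ lLwc E F) (hT : T ∈ lLwc E F) :
    S - T ∈ lLwc E F :=
  mem_lLwc_iff.2 fun x => by
    rw [sub_apply, sub_eq_add_neg]
    exact (mem_lLwc_iff.1 hS x).singleton_add (mem_lLwc_iff.1 hT x).singleton_neg

theorem hasDominationProperty_lLwc [Lattice E] [IsOrderedAddMonoid E] :
    HasDominationProperty (lLwc E F) := by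
  intro S T hS hST hT
  rw [mem_lLwc_iff] at hT ⊢
  have hpos : ∀ x, 0 ≤ x → IsLwcSet {S x} := by
    intro x hx
    have h0 : 0 ≤ S x := hS x hx
    refine (hT x).singleton_of_abs_le ?_
    rw [abs_of_nonneg h0]
    exact (hST x hx).trans (le_abs_self _)
  intro x
  rw [← posPart_sub_negPart x, map_sub, sub_eq_add_neg]
  exact (hpos _ (posPart_nonneg x)).singleton_add (hpos _ (negPart_nonneg x)).singleton_neg

end LimitedlyLwc

end BanachLat

namespace BanachLat

/-! ### The Riesz–Kantorovich theorem -/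

section RieszKantorovich

/-- `SplitSum A x v` states that `v = ∑ T i (x i)` for some decomposition `x = ∑ x i` into finitely
many positive vectors and some operators `T i` in `A`. -/
inductive SplitSum {E F : Type*} [NormedAddCommGroup E] [NormedSpace ℝ E] [Lattice E]
    [NormedAddCommGroup F] [NormedSpace ℝ F] (A : Set (E →L[ℝ] F)) : E → F → Prop
  | zero : SplitSum A 0 0
  | cons {T : E →L[ℝ] F} {z x : E} {v : F} :
      T ∈ A → 0 ≤ z → SplitSum A x v → SplitSum A (z + x) (T z + v)

variable {E F : Type*}
  [NormedAddCommGroup E] [NormedSpace ℝ E] [Lattice E] [IsOrderedAddMonoid E]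
  [NormedAddCommGroup F] [NormedSpace ℝ F] {A : Set (E →L[ℝ] F)}

namespace SplitSum

omit [IsOrderedAddMonoid E] in
theorem single {T : E →L[ℝ] F} (hT : T ∈ A) {x : E} (hx : 0 ≤ x) : SplitSum A x (T x) := by
  simpa using cons hT hx zero

omit [IsOrderedAddMonoid E] in
theorem add {x y : E} {v w : F} (hv : SplitSum A x v) (hw : SplitSum A y w) :
    SplitSum A (x + y) (v + w) := by
  induction hv with
  | zero => simpa using hw
  | cons hT hz _ ih => simpa only [add_assoc] using cons hT hz ih

theorem nonneg {x : E} {v : F} (hv : SplitSum A x v) : 0 ≤ x := by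
  induction hv with
  | zero => exact le_rfl
  | cons _ hz _ ih => exact add_nonneg hz ih

omit [IsOrderedAddMonoid E] in
theorem smul [IsOrderedModule ℝ E] {r : ℝ} (hr : 0 ≤ r) {x : E} {v : F} (hv : SplitSum A x v) :
    SplitSum A (r • x) (r • v) := by
  induction hv with
  | zero => simpa using zero
  | cons hT hz _ ih =>
    rw [smul_add, smul_add, ← map_smul]
    exact cons hT (smul_nonneg hr hz) ih

/-- The Riesz decomposition property, for `SplitSum`. -/
theorem exists_of_add {s : E} {v : F} (hv : SplitSum A s v) :
    ∀ {x y : E}, 0 ≤ x → 0 ≤ y → s = x + y →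
      ∃ v₁ v₂, SplitSum A x v₁ ∧ SplitSum A y v₂ ∧ v = v₁ + v₂ := by
  induction hv with
  | zero =>
    intro x y hx hy h
    obtain ⟨rfl, rfl⟩ := (add_eq_zero_iff_of_nonneg hx hy).1 h.symm
    exact ⟨0, 0, zero, zero, by simp⟩
  | @cons T z u v hT hz hu ih =>
    intro x y hx hy h
    -- The summand `z` is split greedily: `z ⊓ x` goes to `x`, and the rest fits under `y` because
    -- `z ≤ x + y`.
    have hy' : z - z ⊓ x ≤ y := by
      rw [sub_le_iff_le_add, add_inf]
      refine le_inf (le_add_of_nonneg_left hy) ?_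
      rw [add_comm y x, ← h]
      exact le_add_of_nonneg_right hu.nonneg
    obtain ⟨v₁, v₂, h₁, h₂, rfl⟩ := ih (x := x - z ⊓ x) (y := y - (z - z ⊓ x))
      (sub_nonneg.2 inf_le_right) (sub_nonneg.2 hy') (by
        have : u = x + y - z := by rw [← h]; abel
        rw [this]; abel)
    refine ⟨T (z ⊓ x) + v₁, T (z - z ⊓ x) + v₂, ?_, ?_, ?_⟩
    · simpa using cons hT (le_inf hz hx) h₁
    · simpa using cons hT (sub_nonneg.2 (inf_le_left : z ⊓ x ≤ z)) h₂
    · rw [map_sub]; abel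

omit [IsOrderedAddMonoid E] in
theorem le [Lattice F] [IsOrderedAddMonoid F] {S : E →L[ℝ] F}
    (hS : ∀ T ∈ A, ∀ x, 0 ≤ x → T x ≤ S x) {x : E} {v : F} (hv : SplitSum A x v) : v ≤ S x := by
  induction hv with
  | zero => simp
  | cons hT hz _ ih =>
    rw [map_add]
    exact add_le_add (hS _ hT _ hz) ih

-- The supremum of a Minkowski sum is the sum of the suprema, so this makes the supremum operator
-- additive on the cone.
open scoped Pointwise in
theorem setOf_add {x y : E} (hx : 0 ≤ x) (hy : 0 ≤ y) :
    {v : F | SplitSum A (x + y) v} = {v | SplitSum A x v} + {v | SplitSum A y v} := by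
  ext v
  refine ⟨fun h => ?_, ?_⟩
  · obtain ⟨v₁, v₂, h₁, h₂, rfl⟩ := h.exists_of_add hx hy rfl
    exact Set.add_mem_add h₁ h₂
  · rintro ⟨v₁, h₁, v₂, h₂, rfl⟩
    exact add h₁ h₂

end SplitSum

/-- An additive and positively homogeneous map on the positive cone extends to a linear map. -/
theorem exists_linearMap_of_nonneg {E F : Type*} [AddCommGroup E] [Module ℝ E] [Lattice E]
    [IsOrderedAddMonoid E] [IsOrderedModule ℝ E] [AddCommGroup F] [Module ℝ F] (f : E → F)
    (hadd : ∀ x y, 0 ≤ x → 0 ≤ y → f (x + y) = f x + f y)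
    (hsmul : ∀ (r : ℝ) x, 0 < r → 0 ≤ x → f (r • x) = r • f x) :
    ∃ g : E →ₗ[ℝ] F, ∀ x, 0 ≤ x → g x = f x := by
  have h0 : f 0 = 0 := by simpa using hadd 0 0 le_rfl le_rfl
  -- The value does not depend on how `x` is written as a difference of positive vectors.
  have key : ∀ x a b : E, 0 ≤ a → 0 ≤ b → x = a - b → f x⁺ - f x⁻ = f a - f b := by
    intro x a b ha hb hx
    rw [sub_eq_sub_iff_add_eq_add, ← hadd _ _ (posPart_nonneg x) hb,
      ← hadd _ _ ha (negPart_nonneg x)]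
    congr 1
    rw [← sub_eq_sub_iff_add_eq_add, posPart_sub_negPart, hx]
  refine ⟨{ toFun := fun x => f x⁺ - f x⁻, map_add' := ?_, map_smul' := ?_ }, ?_⟩
  · intro x y
    rw [key (x + y) (x⁺ + y⁺) (x⁻ + y⁻) (add_nonneg (posPart_nonneg x) (posPart_nonneg y))
      (add_nonneg (negPart_nonneg x) (negPart_nonneg y)),
      hadd _ _ (posPart_nonneg x) (posPart_nonneg y),
      hadd _ _ (negPart_nonneg x) (negPart_nonneg y)]
    · abel
    · rw [add_sub_add_comm, posPart_sub_negPart, posPart_sub_negPart]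
  · intro r x
    rw [RingHom.id_apply]
    rcases lt_trichotomy r 0 with hr | rfl | hr
    · have hr' : 0 < -r := neg_pos.2 hr
      rw [key (r • x) ((-r) • x⁻) ((-r) • x⁺) (smul_nonneg hr'.le (negPart_nonneg x))
        (smul_nonneg hr'.le (posPart_nonneg x)), hsmul _ _ hr' (posPart_nonneg x),
        hsmul _ _ hr' (negPart_nonneg x)]
      · module
      · nth_rewrite 1 [← posPart_sub_negPart x]
        module
    · simp [h0]
    · rw [key (r • x) (r • x⁺) (r • x⁻) (smul_nonneg hr.le (posPart_nonneg x))
        (smul_nonneg hr.le (negPart_nonneg x)), hsmul _ _ hr (posPart_nonneg x),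
        hsmul _ _ hr (negPart_nonneg x), smul_sub]
      rw [← smul_sub, posPart_sub_negPart]
  · intro x hx
    simp [posPart_of_nonneg hx, negPart_of_nonneg hx, h0]

/-- A linear map between a bounded operator and another one on the positive cone is bounded. -/
theorem exists_continuousLinearMap_of_between [HasSolidNorm E] [Lattice F] [IsOrderedAddMonoid F]
    [HasSolidNorm F] (g : E →ₗ[ℝ] F) (S T : E →L[ℝ] F) (hS : ∀ x, 0 ≤ x → S x ≤ g x)
    (hT : ∀ x, 0 ≤ x → g x ≤ T x) : ∃ G : E →L[ℝ] F, ∀ x, G x = g x := by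
  -- On the cone `0 ≤ g x - S x ≤ (T - S) x`, so solidity of the norm gives the bound.
  have hpos : ∀ x, 0 ≤ x → ‖g x - S x‖ ≤ ‖T - S‖ * ‖x‖ := by
    intro x hx
    refine (norm_le_norm_of_abs_le_abs ?_).trans ((T - S).le_opNorm x)
    rw [sub_apply, abs_of_nonneg (sub_nonneg.2 (hS x hx)),
      abs_of_nonneg (sub_nonneg.2 ((hS x hx).trans (hT x hx)))]
    exact sub_le_sub_right (hT x hx) _
  have hp : ∀ x : E, ‖x⁺‖ ≤ ‖x‖ := fun x => norm_le_norm_of_abs_le_abs (by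
    rw [abs_of_nonneg (posPart_nonneg x), ← posPart_add_negPart x]
    exact le_add_of_nonneg_right (negPart_nonneg x))
  have hn : ∀ x : E, ‖x⁻‖ ≤ ‖x‖ := fun x => norm_le_norm_of_abs_le_abs (by
    rw [abs_of_nonneg (negPart_nonneg x), ← posPart_add_negPart x]
    exact le_add_of_nonneg_left (posPart_nonneg x))
  refine ⟨g.mkContinuous (‖T - S‖ + ‖T - S‖ + ‖S‖) fun x => ?_, fun x => rfl⟩
  have hx : g x = (g x⁺ - S x⁺) - (g x⁻ - S x⁻) + S x := by
    have hg : g x = g x⁺ - g x⁻ := by rw [← map_sub, posPart_sub_negPart]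
    have hS : S x = S x⁺ - S x⁻ := by rw [← map_sub, posPart_sub_negPart]
    rw [hg, hS]
    abel
  calc ‖g x‖ ≤ ‖g x⁺ - S x⁺‖ + ‖g x⁻ - S x⁻‖ + ‖S x‖ := by
        nth_rewrite 1 [hx]
        exact (norm_add_le _ _).trans (add_le_add_left (norm_sub_le _ _) _)
    _ ≤ ‖T - S‖ * ‖x‖ + ‖T - S‖ * ‖x‖ + ‖S‖ * ‖x‖ := by
        refine add_le_add (add_le_add ?_ ?_) (S.le_opNorm x)
        · exact (hpos _ (posPart_nonneg x)).trans
            (mul_le_mul_of_nonneg_left (hp x) (norm_nonneg _))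
        · exact (hpos _ (negPart_nonneg x)).trans
            (mul_le_mul_of_nonneg_left (hn x) (norm_nonneg _))
    _ = _ := by ring

/-- **Riesz–Kantorovich**: if `F` is Dedekind complete, then so is the space of bounded
operators from `E` to `F`. -/
theorem isDedekindComplete_operators [IsOrderedModule ℝ E] [HasSolidNorm E] [Lattice F]
    [IsOrderedAddMonoid F] [IsOrderedModule ℝ F] [HasSolidNorm F] (hF : IsDedekindComplete F) :
    IsDedekindComplete (E →L[ℝ] F) := by
  rintro A ⟨S, hS⟩ ⟨U, hU⟩
  -- The value at `x` is the supremum of all split sums, which `U x` bounds; outside the cone the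
  -- default `0` plays no role.
  have hex : ∀ x : E, ∃ s : F, 0 ≤ x → IsLUB {v | SplitSum A x v} s := by
    intro x
    by_cases hx : 0 ≤ x
    · obtain ⟨s, hs⟩ := hF {v | SplitSum A x v} ⟨S x, SplitSum.single hS hx⟩
        ⟨U x, fun v hv => hv.le fun T hT => hU hT⟩
      exact ⟨s, fun _ => hs⟩
    · exact ⟨0, fun h => absurd h hx⟩
  choose f hf using hex
  obtain ⟨g, hg⟩ := exists_linearMap_of_nonneg f
    (by
      intro x y hx hy
      have h := hf _ (add_nonneg hx hy)
      rw [SplitSum.setOf_add hx hy] at h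
      exact h.unique ((hf x hx).add (hf y hy)))
    (by
      intro r x hr hx
      have himage : {v : F | SplitSum A (r • x) v} =
          OrderIso.smulRight hr '' {v | SplitSum A x v} := by
        ext v
        refine ⟨fun h => ⟨r⁻¹ • v, ?_, smul_inv_smul₀ hr.ne' v⟩, ?_⟩
        · simpa [inv_smul_smul₀ hr.ne'] using h.smul (inv_nonneg.2 hr.le)
        · rintro ⟨w, hw, rfl⟩
          exact SplitSum.smul hr.le hw
      have h := hf _ (smul_nonneg hr.le hx)
      rw [himage] at h
      exact h.unique ((OrderIso.smulRight hr).isLUB_image'.2 (hf x hx)))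
  have hle : ∀ T ∈ A, ∀ x, 0 ≤ x → T x ≤ g x := fun T hT x hx => by
    rw [hg x hx]
    exact (hf x hx).1 (SplitSum.single hT hx)
  have hge : ∀ V : E →L[ℝ] F, V ∈ upperBounds A → ∀ x, 0 ≤ x → g x ≤ V x := fun V hV x hx => by
    rw [hg x hx]
    exact (hf x hx).2 fun v hv => SplitSum.le (fun T hT => hV hT) hv
  obtain ⟨G, hG⟩ := exists_continuousLinearMap_of_between g S U (hle S hS) (hge U hU)
  refine ⟨G, fun T hT x hx => ?_, fun V hV x hx => ?_⟩
  · rw [hG]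
    exact hle T hT x hx
  · rw [hG]
    exact hge V hV x hx

end RieszKantorovich

end BanachLat

namespace BanachLat

/-! ### r-`P`-operators and regular operators -/

section RegularOperators

variable {E F : Type*}
  [NormedAddCommGroup E] [NormedSpace ℝ E] [Lattice E] [IsOrderedAddMonoid E]
  [NormedAddCommGroup F] [NormedSpace ℝ F] [Lattice F] [IsOrderedAddMonoid F]
  [IsOrderedModule ℝ F]

instance instOperatorIsOrderedAddMonoid : IsOrderedAddMonoid (E →L[ℝ] F) where
  add_le_add_left S T h U x hx := by
    simpa using h x hx

instance instOperatorPosSMulMono : PosSMulMono ℝ (E →L[ℝ] F) where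
  smul_le_smul_of_nonneg_left _ hr _ _ h x hx :=
    smul_le_smul_of_nonneg_left (h x hx) hr

omit [IsOrderedModule ℝ F] in
theorem nonneg_of_le_of_neg_le {T U : E →L[ℝ] F} (h₁ : T ≤ U) (h₂ : -T ≤ U) : 0 ≤ U :=
  fun x hx => (abs_nonneg (T x)).trans (sup_le (h₁ x hx) (h₂ x hx))

theorem mem_rOps_iff {P : Set (E →L[ℝ] F)} (hadd : ∀ S ∈ P, ∀ T ∈ P, S + T ∈ P)
    (hsub : ∀ S ∈ P, ∀ T ∈ P, S - T ∈ P) {T : E →L[ℝ] F} :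
    T ∈ rOps P ↔ T ∈ P ∧ IsDominatedBy P T := by
  constructor
  · rintro ⟨T₁, h₁, T₂, h₂, hp₁, hp₂, rfl⟩
    refine ⟨hsub _ h₁ _ h₂, T₁ + T₂, hadd _ h₁ _ h₂, ?_, ?_⟩
    · exact (sub_le_self _ hp₂).trans (le_add_of_nonneg_right hp₂)
    · rw [neg_sub]
      exact (sub_le_self _ hp₁).trans (le_add_of_nonneg_left hp₁)
  · rintro ⟨hT, U, hU, h₁, h₂⟩
    refine ⟨U, hU, U - T, hsub _ hU _ hT, ?_, sub_nonneg.2 h₁, by abel⟩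
    exact nonneg_of_le_of_neg_le h₁ h₂

theorem mem_rOps_of_le {P : Set (E →L[ℝ] F)} (hP : HasDominationProperty P)
    {S M U : E →L[ℝ] F} (h₁ : S ≤ M) (h₂ : -S ≤ M) (hM : M ≤ U) (hU : U ∈ P) : S ∈ rOps P := by
  have hp₁ : 0 ≤ (1 / 2 : ℝ) • (M + S) :=
    smul_nonneg (by norm_num) (neg_le_iff_add_nonneg.1 h₂)
  have hp₂ : 0 ≤ (1 / 2 : ℝ) • (M - S) := smul_nonneg (by norm_num) (sub_nonneg.2 h₁)
  have hsum : (1 / 2 : ℝ) • (M + S) + (1 / 2 : ℝ) • (M - S) = M := by module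
  refine ⟨_, hP _ U hp₁ ?_ hU, _, hP _ U hp₂ ?_ hU, hp₁, hp₂, by module⟩
  · exact (le_add_of_nonneg_right hp₂).trans (hsum.trans_le hM)
  · exact (le_add_of_nonneg_left hp₁).trans (hsum.trans_le hM)

theorem IsModulus.le {V : Type*} [Neg V] [Preorder V] {T M : V} (h : IsModulus T M) : T ≤ M :=
  h.1 (Set.mem_insert _ _)

theorem IsModulus.neg_le {V : Type*} [Neg V] [Preorder V] {T M : V} (h : IsModulus T M) :
    -T ≤ M :=
  h.1 (Set.mem_insert_of_mem _ rfl)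

theorem IsModulus.le_of_le {V : Type*} [Neg V] [Preorder V] {T M U : V} (h : IsModulus T M)
    (h₁ : T ≤ U) (h₂ : -T ≤ U) : M ≤ U := by
  refine h.2 ?_
  rintro _ (rfl | rfl)
  exacts [h₁, h₂]

theorem IsModulus.nonneg {T M : E →L[ℝ] F} (h : IsModulus T M) : 0 ≤ M :=
  nonneg_of_le_of_neg_le h.le h.neg_le

theorem mem_rOps_iff_modulus_mem {P : Set (E →L[ℝ] F)} (hadd : ∀ S ∈ P, ∀ T ∈ P, S + T ∈ P)
    (hsub : ∀ S ∈ P, ∀ T ∈ P, S - T ∈ P) (hP : HasDominationProperty P) {T M : E →L[ℝ] F}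
    (h : IsModulus T M) : T ∈ rOps P ↔ M ∈ P := by
  refine ⟨fun hT => ?_, mem_rOps_of_le hP h.le h.neg_le le_rfl⟩
  obtain ⟨-, U, hU, h₁, h₂⟩ := (mem_rOps_iff hadd hsub).1 hT
  exact hP M U h.nonneg (h.le_of_le h₁ h₂) hU

omit [IsOrderedAddMonoid F] [IsOrderedModule ℝ F] in
theorem mem_rOps_of_nonneg {P : Set (E →L[ℝ] F)} (hsub : ∀ S ∈ P, ∀ T ∈ P, S - T ∈ P)
    {T : E →L[ℝ] F} (hT : 0 ≤ T) (hTP : T ∈ P) : T ∈ rOps P :=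
  ⟨T, hTP, 0, by simpa using hsub T hTP T hTP, hT, le_rfl, (sub_zero T).symm⟩

theorem mem_regularOps_of_nonneg {T : E →L[ℝ] F} (hT : 0 ≤ T) : T ∈ regularOps E F :=
  ⟨T, 0, hT, le_rfl, (sub_zero T).symm⟩

/-- Since `T = S + (T - S)`, suprema and dominating operators found among all bounded operators are
again regular. -/
theorem mem_regularOps_of_le {S T : E →L[ℝ] F} (hS : S ∈ regularOps E F) (h : S ≤ T) :
    T ∈ regularOps E F := by
  simpa using (regularOps E F).add_mem hS (mem_regularOps_of_nonneg (sub_nonneg.2 h))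

theorem rOps_subset_regularOps (P : Set (E →L[ℝ] F)) : rOps P ⊆ regularOps E F := by
  rintro _ ⟨T₁, -, T₂, -, h₁, h₂, rfl⟩
  exact ⟨T₁, T₂, h₁, h₂, rfl⟩

theorem isDedekindComplete_regularOps (h : IsDedekindComplete (E →L[ℝ] F)) :
    IsDedekindComplete (regularOps E F) := by
  rintro A ⟨S, hS⟩ ⟨U, hU⟩
  obtain ⟨G, hG⟩ := h (Subtype.val '' A) ⟨S, S, hS, rfl⟩ ⟨U, by
    rintro _ ⟨T, hT, rfl⟩
    exact hU hT⟩
  have hub : ∀ T ∈ A, (T : E →L[ℝ] F) ≤ G := fun T hT => hG.1 ⟨T, hT, rfl⟩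
  refine ⟨⟨G, mem_regularOps_of_le S.2 (hub S hS)⟩, fun T hT => hub T hT, fun V hV => hG.2 ?_⟩
  rintro _ ⟨T, hT, rfl⟩
  exact hV hT

theorem isVectorLattice_regularOps (h : IsDedekindComplete (regularOps E F)) :
    IsVectorLattice (regularOps E F) := by
  have hsup : ∀ S T : regularOps E F, ∃ s, IsLUB {S, T} s := by
    intro S T
    obtain ⟨S₁, S₂, hS₁, hS₂, hS⟩ := S.2
    obtain ⟨T₁, T₂, hT₁, hT₂, hT⟩ := T.2
    -- The sum of the positive terms of the two decompositions bounds both operators.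
    refine h _ ⟨S, Set.mem_insert _ _⟩
      ⟨⟨S₁ + T₁, mem_regularOps_of_nonneg (add_nonneg hS₁ hT₁)⟩, ?_⟩
    rintro _ (rfl | rfl)
    · change (_ : E →L[ℝ] F) ≤ S₁ + T₁
      rw [hS]
      exact (sub_le_self _ hS₂).trans (le_add_of_nonneg_right hT₁)
    · change (_ : E →L[ℝ] F) ≤ S₁ + T₁
      rw [hT]
      exact (sub_le_self _ hT₂).trans (le_add_of_nonneg_left hS₁)
  have hadd : ∀ S T U : regularOps E F, S ≤ T → S + U ≤ T + U := fun S T U hST x hx =>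
    add_le_add_left (hST x hx) (U.1 x)
  have hneg : ∀ S T : regularOps E F, S ≤ T → -T ≤ -S := fun S T hST x hx =>
    neg_le_neg (hST x hx)
  refine ⟨hadd, fun r S T hr hST x hx => smul_le_smul_of_nonneg_left (hST x hx) hr, hsup,
    fun S T => ?_⟩
  obtain ⟨s, hs⟩ := hsup (-S) (-T)
  refine ⟨-s, ?_, fun V hV => ?_⟩
  · rintro _ (rfl | rfl)
    · simpa using hneg _ _ (hs.1 (Set.mem_insert _ _))
    · simpa using hneg _ _ (hs.1 (Set.mem_insert_of_mem _ rfl))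
  · have hVs : s ≤ -V := hs.2 (by
      rintro _ (rfl | rfl)
      · exact hneg _ _ (hV (Set.mem_insert _ _))
      · exact hneg _ _ (hV (Set.mem_insert_of_mem _ rfl)))
    simpa using hneg _ _ hVs

theorem isOrderIdeal_rOps (P : Submodule ℝ (E →L[ℝ] F))
    (hP : HasDominationProperty (P : Set (E →L[ℝ] F))) :
    IsOrderIdeal {T : regularOps E F | (T : E →L[ℝ] F) ∈ rOps (P : Set (E →L[ℝ] F))} where
  zero_mem := ⟨0, P.zero_mem, 0, P.zero_mem, le_rfl, le_rfl, (sub_zero 0).symm⟩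
  add_mem := by
    rintro S T ⟨S₁, hS₁, S₂, hS₂, hp₁, hp₂, hS⟩ ⟨T₁, hT₁, T₂, hT₂, hq₁, hq₂, hT⟩
    refine ⟨S₁ + T₁, P.add_mem hS₁ hT₁, S₂ + T₂, P.add_mem hS₂ hT₂, add_nonneg hp₁ hq₁,
      add_nonneg hp₂ hq₂, ?_⟩
    rw [Submodule.coe_add, hS, hT, add_sub_add_comm]
  smul_mem := by
    rintro r T ⟨T₁, hT₁, T₂, hT₂, hp₁, hp₂, hT⟩
    rw [Set.mem_ofPred_eq, Submodule.coe_smul, hT]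
    rcases le_total 0 r with hr | hr
    · exact ⟨r • T₁, P.smul_mem r hT₁, r • T₂, P.smul_mem r hT₂, smul_nonneg hr hp₁,
        smul_nonneg hr hp₂, smul_sub r T₁ T₂⟩
    · exact ⟨(-r) • T₂, P.smul_mem _ hT₂, (-r) • T₁, P.smul_mem _ hT₁,
        smul_nonneg (neg_nonneg.2 hr) hp₂, smul_nonneg (neg_nonneg.2 hr) hp₁, by module⟩
  solid := by
    intro S T absS absT hS hT hST hTP
    obtain ⟨-, U, hU, h₁, h₂⟩ := (mem_rOps_iff (fun _ hA _ hB => P.add_mem hA hB)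
      (fun _ hA _ hB => P.sub_mem hA hB)).1 hTP
    -- `absT` is least only among regular upper bounds, so `U` must first be seen to be regular.
    have hTU : absT ≤ ⟨U, mem_regularOps_of_le T.2 h₁⟩ := hT.le_of_le h₁ h₂
    exact mem_rOps_of_le hP hS.le hS.neg_le (hST.trans hTU) hU

end RegularOperators

end BanachLat

theorem mainTheorem6 {E F : Type*}
    [NormedAddCommGroup E] [NormedSpace ℝ E] [CompleteSpace E]
    [Lattice E] [IsOrderedAddMonoid E] [IsOrderedModule ℝ E] [HasSolidNorm E]
    [NormedAddCommGroup F] [NormedSpace ℝ F] [CompleteSpace F]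
    [Lattice F] [IsOrderedAddMonoid F] [IsOrderedModule ℝ F] [HasSolidNorm F] :
    -- the lemma on limitedly L-weakly compact operators
    (∀ T absT : E →L[ℝ] F, BanachLat.IsModulus T absT →
      (T ∈ BanachLat.rOps (BanachLat.lLwc E F) ↔ absT ∈ BanachLat.rOps (BanachLat.lLwc E F))) ∧
    -- the two general characterizations of r-`P`-operators
    (∀ P : Set (E →L[ℝ] F), P.Nonempty →
      (∀ S ∈ P, ∀ T ∈ P, S + T ∈ P) → (∀ S ∈ P, ∀ T ∈ P, S - T ∈ P) →
      ∀ T : E →L[ℝ] F,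
        (T ∈ BanachLat.rOps P ↔ T ∈ P ∧ BanachLat.IsDominatedBy P T) ∧
        (BanachLat.HasDominationProperty P →
          ∀ absT : E →L[ℝ] F, BanachLat.IsModulus T absT →
            (T ∈ BanachLat.rOps P ↔ absT ∈ P))) ∧
    -- the r-`P`-operators form an order ideal of the regular operators
    (BanachLat.IsDedekindComplete F →
      BanachLat.IsVectorLattice (BanachLat.regularOps E F) ∧
      BanachLat.IsDedekindComplete (BanachLat.regularOps E F) ∧
      ∀ P : Submodule ℝ (E →L[ℝ] F),
        BanachLat.HasDominationProperty (P : Set (E →L[ℝ] F)) →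
          BanachLat.rOps (P : Set (E →L[ℝ] F)) ⊆ BanachLat.regularOps E F ∧
          BanachLat.IsOrderIdeal {T : BanachLat.regularOps E F |
            (T : E →L[ℝ] F) ∈ BanachLat.rOps (P : Set (E →L[ℝ] F))}) := by
  refine ⟨fun T M h => ?_, fun P _ hadd hsub T => ⟨BanachLat.mem_rOps_iff hadd hsub, fun hP M h =>
    BanachLat.mem_rOps_iff_modulus_mem hadd hsub hP h⟩, fun hF => ?_⟩
  · have hadd : ∀ S ∈ BanachLat.lLwc E F, ∀ T ∈ BanachLat.lLwc E F, S + T ∈ BanachLat.lLwc E F :=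
      fun _ hS _ hT => BanachLat.add_mem_lLwc hS hT
    have hsub : ∀ S ∈ BanachLat.lLwc E F, ∀ T ∈ BanachLat.lLwc E F, S - T ∈ BanachLat.lLwc E F :=
      fun _ hS _ hT => BanachLat.sub_mem_lLwc hS hT
    rw [BanachLat.mem_rOps_iff_modulus_mem hadd hsub BanachLat.hasDominationProperty_lLwc h]
    -- For the positive operator `M`, membership in the class and in its r-version coincide.
    exact ⟨BanachLat.mem_rOps_of_nonneg hsub h.nonneg,
      fun hM => ((BanachLat.mem_rOps_iff hadd hsub).1 hM).1⟩
  · have h := BanachLat.isDedekindComplete_regularOps (BanachLat.isDedekindComplete_operators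
      (E := E) hF)
    exact ⟨BanachLat.isVectorLattice_regularOps h, h, fun P hP =>
      ⟨BanachLat.rOps_subset_regularOps _, BanachLat.isOrderIdeal_rOps P hP⟩⟩
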